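/- Let $\Omega\subset\mathbb R^2$ be open, with a conforming triangulation into finitely many non-degenerate triangles: $\overline\Omega=\bigcup_{k=1}^{n_{el}}\overline{\Omega_k}$, the $\Omega_k\subseteq\Omega$ are pairwise disjoint open triangles, and two closed triangles meet in the convex hull of their common vertices. Let $h_k=\operatorname{diam}\Omega_k$. Let $D_x,D_y,u,v\in C^1(\Omega)$ be bounded, with $D_x,D_y\ge D_0>0$ and $\partial_xu+\partial_yv=0$ in $\Omega$; let $\mu>0$ be a constant and $q\in L_2(\Omega)$. Put $V=H^1_0(\Omega)$, $\bar u=(u,v)$, $$a(c,d)=\int_\Omega\big(D_xc_xd_x+D_yc_yd_y+d\,\bar u\cdot\nabla c+\mu cd\big),\qquad l(d)=\int_\Omega qd,$$ $$\|d\|_E=a(d,d)^{1/2},\qquad \|d\|_{E,\Omega_k}^2=\int_{\Omega_k}\big(D_xd_x^2+D_yd_y^2+\mu d^2\big),$$ and let $V_h\subset V$ be the space of all functions in $V$ that are continuous on $\overline\Omega$ and affine on each $\overline{\Omega_k}$ (P1 elements). For a function $d\in V$ that is continuous on $\overline\Omega$, a nodal interpolant of $d$ is a $\tilde d_h\in V_h$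 that agrees with $d$ at all vertices of the triangulation. We say that a function $\eta$ vanishes on the inter-element boundaries if $\eta|_{\Omega_k}\in H^1_0(\Omega_k)$ for every $k$. Let $c\in V$ be the weak solution, $a(c,d)=l(d)$ for all $d\in V$, and $c_h\in V_h$ the Galerkin solution, $a(c_h,d_h)=l(d_h)$ for all $d_h\in V_h$. Assume that $c$ is continuous on $\overline\Omega$, that it has a nodal interpolant $\tilde c_h$, and that the interpolation error $\eta_c=\tilde c_h-c$ vanishes on the inter-element boundaries. Let $$r_h=-\partial_x(D_x\partial_xc_h)-\partial_y(D_y\partial_yc_h)+\bar u\cdot\nabla c_h+\mu c_h-q\quad\text{in each }\Omega_k,$$ $$C_{I,k}=\sup_d\frac{h_k^{-1}\|\tilde d_h-d\|_{L_2(\Omega_k)}}{\|d\|_{E,\Omega_k}}\qquad(0/0:=0),$$ where the supremum is over all $d\in V$, continuous on $\overline\Omega$ and having a nodal interpolant $\tilde d_h$, for which $\tilde d_h-d$ vanishes on the inter-element boundaries. Then the constants $C_{I,k}$ are bounded independently of the mesh, $C_{I,k}\le D_0^{-1/2}$, and the error $e=c_h-c$ satisfies $$\|e\|_E\le\sum_{k=1}^{n_{el}}C_{I,k}\,h_k\,\|r_h\|_{L_2(\Omega_k)}$$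 (the right-hand side being $+\infty$ if some $\|r_h\|_{L_2(\Omega_k)}$ is). -/

import Mathlib

open MeasureTheory
open scoped ContDiff ENNReal

noncomputable section

namespace ADR

/-- The Euclidean plane, with coordinates `x 0`, `x 1`. -/
abbrev Plane : Type := EuclideanSpace ℝ (Fin 2)

/-- The classical partial derivative `∂f/∂x_i`. -/
def pderiv (i : Fin 2) (f : Plane → ℝ) (x : Plane) : ℝ :=
  fderiv ℝ f x (EuclideanSpace.single i 1)

/-! ### Sobolev spaces on an open set `U` of the plane

Functions are represented by maps `Plane → ℝ`; only their values on `U` matter. -/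

/-- `φ ∈ C_c^∞(U)`. -/
def IsTest (U : Set Plane) (φ : Plane → ℝ) : Prop :=
  ContDiff ℝ ∞ φ ∧ HasCompactSupport φ ∧ tsupport φ ⊆ U

/-- The `L²(U)` norm, with value `∞` for functions outside `L²(U)`. -/
def normL2 (U : Set Plane) (f : Plane → ℝ) : ℝ≥0∞ :=
  eLpNorm f 2 (volume.restrict U)

/-- `g ∈ L²(U)` is the weak partial derivative `∂f/∂x_i` on `U`. -/
def HasWeakPartial (U : Set Plane) (i : Fin 2) (f g : Plane → ℝ) : Prop :=
  MemLp g 2 (volume.restrict U) ∧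
    ∀ φ : Plane → ℝ, IsTest U φ →
      ∫ x in U, f x * pderiv i φ x = - ∫ x in U, g x * φ x

open Classical in
/-- The weak partial derivative on `U` (unique up to null sets; `0` if there is none in `L²(U)`). -/
def wderiv (U : Set Plane) (i : Fin 2) (f : Plane → ℝ) : Plane → ℝ :=
  if h : ∃ g, HasWeakPartial U i f g then h.choose else 0

/-- `f ∈ H¹(U)`. -/
def MemH1 (U : Set Plane) (f : Plane → ℝ) : Prop :=
  MemLp f 2 (volume.restrict U) ∧ ∀ i, ∃ g, HasWeakPartial U i f g

/-- `f ∈ H¹₀(U)`, the closure of `C_c^∞(U)` in `H¹(U)`. -/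
def MemH10 (U : Set Plane) (f : Plane → ℝ) : Prop :=
  MemH1 U f ∧ ∀ ε : ℝ≥0∞, 0 < ε → ∃ φ : Plane → ℝ, IsTest U φ ∧
    normL2 U (f - φ) < ε ∧ ∀ i, normL2 U (wderiv U i f - pderiv i φ) < ε

/-! ### The advection-diffusion-reaction problem

`D 0, D 1` are the diffusion coefficients `D_x, D_y`, and `b 0, b 1` the velocity components. -/

/-- The bilinear form
`a(c,d) = ∫ D_x c_x d_x + ∫ D_y c_y d_y + ∫ d (b · ∇c) + ∫ μ c d`. -/
def aForm (Ω : Set Plane) (D b : Fin 2 → Plane → ℝ) (μ : ℝ) (c d : Plane → ℝ) : ℝ :=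
  (∑ i, ∫ x in Ω, D i x * wderiv Ω i c x * wderiv Ω i d x)
    + (∫ x in Ω, d x * ∑ i, b i x * wderiv Ω i c x)
    + ∫ x in Ω, μ * c x * d x

/-- The linear form `l(d) = ∫ q d`. -/
def lForm (Ω : Set Plane) (q d : Plane → ℝ) : ℝ := ∫ x in Ω, q x * d x

/-- `c` is a weak solution: `c ∈ V = H¹₀(Ω)` and `a(c,d) = l(d)` for all `d ∈ V`. -/
def IsWeakSolution (Ω : Set Plane) (D b : Fin 2 → Plane → ℝ) (μ : ℝ) (q c : Plane → ℝ) : Prop :=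
  MemH10 Ω c ∧ ∀ d, MemH10 Ω d → aForm Ω D b μ c d = lForm Ω q d

/-- The energy norm `‖d‖_E = a(d,d)^{1/2}`. -/
def energyNorm (Ω : Set Plane) (D b : Fin 2 → Plane → ℝ) (μ : ℝ) (d : Plane → ℝ) : ℝ :=
  √(aForm Ω D b μ d d)

/-- The energy norm over a subdomain `U ⊆ Ω` of a function `d ∈ H¹(Ω)`, which is given by the
symmetric part of the form:
`‖d‖_{E,U}² = ∫_U D_x d_x² + D_y d_y² + μ d²`. -/
def localEnergyNorm (Ω : Set Plane) (D : Fin 2 → Plane → ℝ) (μ : ℝ) (U : Set Plane)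
    (d : Plane → ℝ) : ℝ :=
  √(∫ x in U, (∑ i, D i x * wderiv Ω i d x ^ 2) + μ * d x ^ 2)

/-! ### Triangulations and P1 elements -/

/-- A conforming triangulation of `Ω` into `n` triangles. -/
structure Triangulation (Ω : Set Plane) (n : ℕ) where
  /-- the three vertices of each triangle -/
  vertex : Fin n → Fin 3 → Plane
  nondegenerate : ∀ k, AffineIndependent ℝ (vertex k)
  cover : closure Ω = ⋃ k, convexHull ℝ (Set.range (vertex k))
  interior_subset : ∀ k, interior (convexHull ℝ (Set.range (vertex k))) ⊆ Ω
  disjoint : ∀ k l, k ≠ l → Disjoint (interior (convexHull ℝ (Set.range (vertex k))))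
    (interior (convexHull ℝ (Set.range (vertex l))))
  conforming : ∀ k l, convexHull ℝ (Set.range (vertex k)) ∩ convexHull ℝ (Set.range (vertex l)) =
    convexHull ℝ (Set.range (vertex k) ∩ Set.range (vertex l))

namespace Triangulation

variable {Ω : Set Plane} {n : ℕ}

/-- The closed triangle with index `k`. -/
def cell (M : Triangulation Ω n) (k : Fin n) : Set Plane :=
  convexHull ℝ (Set.range (M.vertex k))

/-- The element subdomain `Ω_k` (an open triangle). -/
def elem (M : Triangulation Ω n) (k : Fin n) : Set Plane := interior (M.cell k)

/-- The element diameter `h_k`. -/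
def diam (M : Triangulation Ω n) (k : Fin n) : ℝ := Metric.diam (M.cell k)

/-- The P1 finite element space `V_h ⊆ V`: continuous functions in `H¹₀(Ω)` that are affine on
every triangle. -/
def MemVh (M : Triangulation Ω n) (v : Plane → ℝ) : Prop :=
  MemH10 Ω v ∧ ContinuousOn v (closure Ω) ∧
    ∀ k, ∃ A : Plane →ᵃ[ℝ] ℝ, Set.EqOn v A (M.cell k)

/-- The Galerkin solution: `c_h ∈ V_h` and `a(c_h,d_h) = l(d_h)` for all `d_h ∈ V_h`. -/
def IsGalerkinSolution (M : Triangulation Ω n) (D b : Fin 2 → Plane → ℝ) (μ : ℝ)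
    (q ch : Plane → ℝ) : Prop :=
  M.MemVh ch ∧ ∀ dh, M.MemVh dh → aForm Ω D b μ ch dh = lForm Ω q dh

/-- `d` is continuous up to the boundary and `dh ∈ V_h` is its nodal interpolant. -/
def IsNodalInterpolant (M : Triangulation Ω n) (d dh : Plane → ℝ) : Prop :=
  ContinuousOn d (closure Ω) ∧ M.MemVh dh ∧ ∀ k j, dh (M.vertex k j) = d (M.vertex k j)

/-- `η` vanishes on the inter-element boundaries, i.e. it has zero trace on every `∂Ω_k`. -/
def VanishesOnInterfaces (M : Triangulation Ω n) (η : Plane → ℝ) : Prop :=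
  ∀ k, MemH10 (M.elem k) η

/-- The interpolation constant
`C_{I,k} = sup_d h_k⁻¹ ‖d̃_h - d‖_{L²(Ω_k)} / ‖d‖_{E,Ω_k}` (with `0 / 0 = 0`), the supremum being
over the `d ∈ V` whose interpolation error vanishes on the inter-element boundaries. -/
def interpConst (M : Triangulation Ω n) (D : Fin 2 → Plane → ℝ) (μ : ℝ) (k : Fin n) : ℝ≥0∞ :=
  ⨆ (d : Plane → ℝ) (dh : Plane → ℝ) (_ : MemH10 Ω d) (_ : M.IsNodalInterpolant d dh)
    (_ : M.VanishesOnInterfaces (dh - d)),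
    normL2 (M.elem k) (dh - d) /
      ENNReal.ofReal (M.diam k * localEnergyNorm Ω D μ (M.elem k) d)

end Triangulation

/-- The residual `r_h = -∇·(D_x ∂_x c_h, D_y ∂_y c_h) + b·∇c_h + μ c_h - q`, with classical
derivatives (used in the interior of the elements). -/
def residual (D b : Fin 2 → Plane → ℝ) (μ : ℝ) (q ch : Plane → ℝ) (x : Plane) : ℝ :=
  -(∑ i, pderiv i (fun y => D i y * pderiv i ch y) x) + (∑ i, b i x * pderiv i ch x)
    + μ * ch x - q x

end ADR

end

namespace ADR

/-! ### Test functions -/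

/-! The nodal interpolant of the error `e = ch - c` is `ch - cI`, so the interpolation error of `e`
is `-η` with `η = cI - c`. The interpolation constants, though applied to `e`, thus control `η`
itself: `‖η‖ ≤ C_{I,k} h_k ‖e‖_{E,Ω_k}` in `L²(Ω_k)`. Galerkin orthogonality `a(e, ch - cI) = 0`
gives `a(e,e) = a(e,η) = a(ch,η) - l(η)`. Since `η` lies in `H¹₀` of every element, elementwise
integration by parts leaves no jump terms, and the right side is the sum of the `∫_{Ω_k} r_h η`
whenever the residuals are in `L²`. Cauchy–Schwarz and division by `‖e‖_E` finish the estimate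
(`enorm_integral_residual_le`, `Triangulation.normL2_le_interpConst_mul`).

The bound `D₀^{-1/2}` on the constants combines two facts about `η = dh - d` on a triangle.
Poincaré's inequality gives `‖η‖ ≤ h_k ‖∂₀η‖`. As `∂₀dh` is constant and `∂₀η` has mean zero, the
two are orthogonal, so `‖∂₀η‖ ≤ ‖∂₀d‖`.

One identity, `MemH10.integral_sq_add_convection`, serves twice: with the field `(x₀ - a, 0)` of
divergence 1 it yields Poincaré's inequality, and with the solenoidal velocity it shows that
convection drops out of `a(d,d)`. -/

theorem pderiv_sub {f g : Plane → ℝ} {x : Plane} (hf : DifferentiableAt ℝ f x)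
    (hg : DifferentiableAt ℝ g x) (i : Fin 2) :
    pderiv i (f - g) x = pderiv i f x - pderiv i g x := by
  simp [pderiv, fderiv_sub hf hg]

theorem pderiv_mul {f g : Plane → ℝ} {x : Plane} (hf : DifferentiableAt ℝ f x)
    (hg : DifferentiableAt ℝ g x) (i : Fin 2) :
    pderiv i (fun y => f y * g y) x = f x * pderiv i g x + pderiv i f x * g x := by
  simp only [pderiv, fderiv_fun_mul hf hg, add_apply, smul_apply, smul_eq_mul]
  ring

theorem tsupport_pderiv_subset (i : Fin 2) (φ : Plane → ℝ) :
    tsupport (pderiv i φ) ⊆ tsupport φ := by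
  refine (closure_mono fun x hx => ?_).trans (tsupport_fderiv_subset ℝ)
  rw [Function.mem_support] at hx ⊢
  intro h
  exact hx (by simp [pderiv, h])

namespace IsTest

variable {U : Set Plane} {φ ψ : Plane → ℝ}

theorem mono {W : Set Plane} (h : IsTest U φ) (hUW : U ⊆ W) : IsTest W φ :=
  ⟨h.1, h.2.1, h.2.2.trans hUW⟩

theorem differentiable (h : IsTest U φ) : Differentiable ℝ φ :=
  h.1.differentiable (by simp)

theorem pderiv (h : IsTest U φ) (i : Fin 2) : IsTest U (pderiv i φ) := by
  refine ⟨?_, ?_, (tsupport_pderiv_subset i φ).trans h.2.2⟩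
  · exact (h.1.fderiv_right (m := ∞) (by simp)).clm_apply contDiff_const
  · exact h.2.1.of_isClosed_subset (isClosed_tsupport _) (tsupport_pderiv_subset i φ)

theorem sub (h : IsTest U φ) (h' : IsTest U ψ) : IsTest U (φ - ψ) :=
  ⟨h.1.sub h'.1, h.2.1.sub h'.2.1,
    (tsupport_sub φ ψ).trans (Set.union_subset h.2.2 h'.2.2)⟩

theorem mul (h : IsTest U φ) (h' : IsTest U ψ) : IsTest U (fun x => φ x * ψ x) :=
  ⟨h.1.mul h'.1, h.2.1.mul_right, tsupport_mul_subset_left.trans h.2.2⟩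

theorem memLp (h : IsTest U φ) (p : ℝ≥0∞) (μ : Measure Plane) [IsFiniteMeasureOnCompacts μ] :
    MemLp φ p μ :=
  h.1.continuous.memLp_of_hasCompactSupport h.2.1

/-- A function continuous on `U` times a test function on `U` is integrable. -/
theorem integrable_mul (h : IsTest U φ) (hU : IsOpen U) {F : Plane → ℝ} (hF : ContinuousOn F U) :
    Integrable (fun x => F x * φ x) := by
  have hs : tsupport (fun x => F x * φ x) ⊆ tsupport φ := tsupport_mul_subset_right
  -- Continuity need only be checked on the support of the product, which lies in `U`; the values of
  -- `F` off `U` play no role.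
  refine Continuous.integrable_of_hasCompactSupport (continuous_of_tsupport fun x hx => ?_) ?_
  · exact (hF.continuousAt (hU.mem_nhds (h.2.2 (hs hx)))).mul h.1.continuous.continuousAt
  · exact h.2.1.of_isClosed_subset (isClosed_tsupport _) hs

theorem eq_zero_of_notMem (h : IsTest U φ) {x : Plane} (hx : x ∉ U) : φ x = 0 :=
  image_eq_zero_of_notMem_tsupport fun h' => hx (h.2.2 h')

/-- The integral against a test function on `U` over a larger set is the integral over `U`. -/
theorem setIntegral_mul_of_subset (h : IsTest U φ) {W : Set Plane} (hUW : U ⊆ W)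
    (f : Plane → ℝ) : ∫ x in W, f x * φ x = ∫ x in U, f x * φ x := by
  rw [setIntegral_eq_integral_of_forall_compl_eq_zero,
    setIntegral_eq_integral_of_forall_compl_eq_zero]
  · exact fun x hx => by rw [h.eq_zero_of_notMem hx, mul_zero]
  · exact fun x hx => by rw [h.eq_zero_of_notMem fun h' => hx (hUW h'), mul_zero]

/-- Integration by parts against a test function. -/
theorem setIntegral_mul_pderiv (h : IsTest U φ) (hU : IsOpen U) {F : Plane → ℝ}
    (hF : ContDiffOn ℝ 1 F U) (i : Fin 2) :
    ∫ x in U, F x * ADR.pderiv i φ x = - ∫ x in U, ADR.pderiv i F x * φ x := by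
  have hd : ContinuousOn (ADR.pderiv i F) U :=
    (hF.continuousOn_fderiv_of_isOpen hU le_rfl).clm_apply continuousOn_const
  rw [setIntegral_eq_integral_of_forall_compl_eq_zero,
    setIntegral_eq_integral_of_forall_compl_eq_zero]
  · exact integral_mul_fderiv_eq_neg_fderiv_mul_of_integrable (h.integrable_mul hU hd)
      ((h.pderiv i).integrable_mul hU hF.continuousOn) (h.integrable_mul hU hF.continuousOn)
      (fun x hx => (hF.differentiableOn one_ne_zero).differentiableAt (hU.mem_nhds (h.2.2 hx)))
      (fun x _ => h.differentiable x)
  · exact fun x hx => by rw [h.eq_zero_of_notMem hx, mul_zero]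
  · exact fun x hx => by rw [(h.pderiv i).eq_zero_of_notMem hx, mul_zero]

end IsTest

/-! ### Weak derivatives -/

variable {U W : Set Plane} {f g : Plane → ℝ}

theorem _root_.MeasureTheory.MemLp.integrable_fun_mul {α : Type*} {m : MeasurableSpace α}
    {μ : Measure α} {f g : α → ℝ} (hf : MemLp f 2 μ) (hg : MemLp g 2 μ) :
    Integrable (fun x => f x * g x) μ :=
  hf.integrable_mul hg

theorem _root_.MeasureTheory.MemLp.top_mul_two {α : Type*} {m : MeasurableSpace α}
    {μ : Measure α} {f g : α → ℝ} (hf : MemLp f ∞ μ) (hg : MemLp g 2 μ) :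
    MemLp (fun x => f x * g x) 2 μ :=
  hg.mul hf

theorem enorm_integral_mul_le {α : Type*} {m : MeasurableSpace α}
    {μ : Measure α} {f g : α → ℝ} (hf : MemLp f 2 μ) (hg : MemLp g 2 μ) :
    ‖∫ x, f x * g x ∂μ‖ₑ ≤ eLpNorm f 2 μ * eLpNorm g 2 μ := by
  refine (enorm_integral_le_lintegral_enorm _).trans ?_
  rw [← eLpNorm_one_eq_lintegral_enorm]
  exact eLpNorm_smul_le_mul_eLpNorm (f := g) (φ := f) hg.1 hf.1

theorem HasWeakPartial.mono {i : Fin 2} (h : HasWeakPartial W i f g) (hUW : U ⊆ W) :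
    HasWeakPartial U i f g := by
  refine ⟨h.1.mono_measure (Measure.restrict_mono hUW le_rfl), fun φ hφ => ?_⟩
  rw [← (hφ.pderiv i).setIntegral_mul_of_subset hUW, ← hφ.setIntegral_mul_of_subset hUW]
  exact h.2 φ (hφ.mono hUW)

/-- This is the fundamental lemma of the calculus of variations. Since `wderiv` is picked by choice,
all its calculus rules hold only almost everywhere and rest on this uniqueness. -/
theorem HasWeakPartial.ae_eq (hU : IsOpen U) {i : Fin 2} {g' : Plane → ℝ}
    (h : HasWeakPartial U i f g) (h' : HasWeakPartial U i f g') :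
    g =ᵐ[volume.restrict U] g' := by
  have hm := h.1.sub h'.1
  have hloc : LocallyIntegrableOn (g - g') U :=
    locallyIntegrableOn_of_locallyIntegrable_restrict (hm.locallyIntegrable one_le_two)
  have := hU.ae_eq_zero_of_integral_contDiff_smul_eq_zero hloc fun φ h1 h2 h3 => by
    have hφ : IsTest U φ := ⟨h1, h2, h3⟩
    have e : ∫ x, φ x • (g - g') x = ∫ x in U, (g x * φ x - g' x * φ x) := by
      rw [← setIntegral_eq_integral_of_forall_compl_eq_zero (s := U)]
      · refine integral_congr_ae (.of_forall fun x => ?_)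
        simp only [smul_eq_mul, Pi.sub_apply]
        ring
      · exact fun x hx => by rw [hφ.eq_zero_of_notMem hx, zero_smul]
    rw [e, integral_sub (h.1.integrable_fun_mul (hφ.memLp 2 _))
      (h'.1.integrable_fun_mul (hφ.memLp 2 _))]
    linarith [h.2 φ hφ, h'.2 φ hφ]
  rw [Filter.EventuallyEq, ae_restrict_iff' hU.measurableSet]
  filter_upwards [this] with x hx hxU
  simpa [sub_eq_zero] using hx hxU

theorem MemH1.hasWeakPartial (h : MemH1 U f) (i : Fin 2) :
    HasWeakPartial U i f (wderiv U i f) := by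
  rw [wderiv, dif_pos (h.2 i)]
  exact (h.2 i).choose_spec

theorem MemH1.memLp_wderiv (h : MemH1 U f) (i : Fin 2) :
    MemLp (wderiv U i f) 2 (volume.restrict U) :=
  (h.hasWeakPartial i).1

theorem MemH1.mono (h : MemH1 W f) (hUW : U ⊆ W) : MemH1 U f :=
  ⟨h.1.mono_measure (Measure.restrict_mono hUW le_rfl),
    fun i => ⟨_, (h.hasWeakPartial i).mono hUW⟩⟩

theorem HasWeakPartial.wderiv_ae_eq (hU : IsOpen U) {i : Fin 2} (h : HasWeakPartial U i f g) :
    wderiv U i f =ᵐ[volume.restrict U] g := by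
  have he : ∃ g, HasWeakPartial U i f g := ⟨g, h⟩
  rw [wderiv, dif_pos he]
  exact he.choose_spec.ae_eq hU h

theorem MemH1.wderiv_ae_eq_of_subset (hU : IsOpen U) (h : MemH1 W f) (hUW : U ⊆ W) (i : Fin 2) :
    wderiv W i f =ᵐ[volume.restrict U] wderiv U i f :=
  (((h.hasWeakPartial i).mono hUW).wderiv_ae_eq hU).symm

theorem MemH1.hasWeakPartial_sub (hf : MemH1 U f) (hg : MemH1 U g) (i : Fin 2) :
    HasWeakPartial U i (f - g) (wderiv U i f - wderiv U i g) := by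
  refine ⟨(hf.memLp_wderiv i).sub (hg.memLp_wderiv i), fun φ hφ => ?_⟩
  have h1 := hφ.memLp 2 (volume.restrict U)
  have h2 := (hφ.pderiv i).memLp 2 (volume.restrict U)
  simp only [Pi.sub_apply, sub_mul]
  rw [integral_sub (hf.1.integrable_fun_mul h2) (hg.1.integrable_fun_mul h2),
    integral_sub ((hf.memLp_wderiv i).integrable_fun_mul h1)
      ((hg.memLp_wderiv i).integrable_fun_mul h1),
    (hf.hasWeakPartial i).2 φ hφ, (hg.hasWeakPartial i).2 φ hφ]
  ring

theorem MemH1.sub (hf : MemH1 U f) (hg : MemH1 U g) : MemH1 U (f - g) :=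
  ⟨hf.1.sub hg.1, fun i => ⟨_, hf.hasWeakPartial_sub hg i⟩⟩

theorem MemH1.wderiv_sub (hU : IsOpen U) (hf : MemH1 U f) (hg : MemH1 U g) (i : Fin 2) :
    wderiv U i (f - g) =ᵐ[volume.restrict U] wderiv U i f - wderiv U i g :=
  (hf.hasWeakPartial_sub hg i).wderiv_ae_eq hU

theorem MemH10.sub (hU : IsOpen U) (hf : MemH10 U f) (hg : MemH10 U g) : MemH10 U (f - g) := by
  refine ⟨hf.1.sub hg.1, fun ε hε => ?_⟩
  obtain ⟨φ, hφ, a0, a1⟩ := hf.2 (ε / 2) (ENNReal.half_pos hε.ne')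
  obtain ⟨ψ, hψ, b0, b1⟩ := hg.2 (ε / 2) (ENNReal.half_pos hε.ne')
  refine ⟨φ - ψ, hφ.sub hψ, ?_, fun i => ?_⟩
  · have e : f - g - (φ - ψ) = (f - φ) - (g - ψ) := by abel
    calc normL2 U (f - g - (φ - ψ)) ≤ normL2 U (f - φ) + normL2 U (g - ψ) := by
          rw [e]
          exact eLpNorm_sub_le (hf.1.1.sub (hφ.memLp 2 _)).1 (hg.1.1.sub (hψ.memLp 2 _)).1
            one_le_two
      _ < ε / 2 + ε / 2 := ENNReal.add_lt_add a0 b0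
      _ = ε := ENNReal.add_halves ε
  · have e : wderiv U i (f - g) - pderiv i (φ - ψ) =ᵐ[volume.restrict U]
        (wderiv U i f - pderiv i φ) - (wderiv U i g - pderiv i ψ) := by
      filter_upwards [hf.1.wderiv_sub hU hg.1 i] with x hx
      simp only [Pi.sub_apply] at hx ⊢
      rw [hx, pderiv_sub (hφ.differentiable x) (hψ.differentiable x)]
      ring
    calc normL2 U (wderiv U i (f - g) - pderiv i (φ - ψ))
        ≤ normL2 U (wderiv U i f - pderiv i φ) + normL2 U (wderiv U i g - pderiv i ψ) := by
          rw [normL2, eLpNorm_congr_ae e]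
          exact eLpNorm_sub_le ((hf.1.memLp_wderiv i).sub ((hφ.pderiv i).memLp 2 _)).1
            ((hg.1.memLp_wderiv i).sub ((hψ.pderiv i).memLp 2 _)).1 one_le_two
      _ < ε / 2 + ε / 2 := ENNReal.add_lt_add (a1 i) (b1 i)
      _ = ε := ENNReal.add_halves ε

/-! ### Passing from test functions to `H¹₀` -/

/-- A linear identity with coefficients in `L²` passes from test functions to `H¹₀`. -/
theorem MemH10.integral_eq_zero (hf : MemH10 U f) {G₀ : Plane → ℝ} {G : Fin 2 → Plane → ℝ}
    (hG₀ : MemLp G₀ 2 (volume.restrict U)) (hG : ∀ i, MemLp (G i) 2 (volume.restrict U))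
    (h : ∀ φ, IsTest U φ → (∫ x in U, G₀ x * φ x) + ∑ i, ∫ x in U, G i x * pderiv i φ x = 0) :
    (∫ x in U, G₀ x * f x) + ∑ i, ∫ x in U, G i x * wderiv U i f x = 0 := by
  set T := (∫ x in U, G₀ x * f x) + ∑ i, ∫ x in U, G i x * wderiv U i f x
  set K := normL2 U G₀ + ∑ i, normL2 U (G i) with hK
  have hKfin : K ≠ ⊤ := by
    simpa [hK, normL2] using ⟨hG₀.2.ne, (hG 0).2.ne, (hG 1).2.ne⟩
  -- The functional is continuous in the `H¹` norm with finite constant `K` and vanishes on test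
  -- functions, so its value at `f` is bounded by `K` times the distance to an approximating test
  -- function.
  have hle : ∀ ε : ℝ≥0∞, 0 < ε → ‖T‖ₑ ≤ K * ε := by
    intro ε hε
    obtain ⟨φ, hφ, a0, a1⟩ := hf.2 ε hε
    have m0 := hf.1.1.sub (hφ.memLp 2 (volume.restrict U))
    have m1 := fun i => (hf.1.memLp_wderiv i).sub ((hφ.pderiv i).memLp 2 (volume.restrict U))
    have e : T = (∫ x in U, G₀ x * (f - φ) x)
        + ∑ i, ∫ x in U, G i x * (wderiv U i f - pderiv i φ) x := by
      have e0 : ∫ x in U, G₀ x * (f - φ) x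
          = (∫ x in U, G₀ x * f x) - ∫ x in U, G₀ x * φ x := by
        rw [← integral_sub (hG₀.integrable_fun_mul hf.1.1)
          (hG₀.integrable_fun_mul (hφ.memLp 2 _))]
        simp only [Pi.sub_apply, mul_sub]
      have e1 : ∀ i, ∫ x in U, G i x * (wderiv U i f - pderiv i φ) x
          = (∫ x in U, G i x * wderiv U i f x) - ∫ x in U, G i x * pderiv i φ x := by
        intro i
        rw [← integral_sub ((hG i).integrable_fun_mul (hf.1.memLp_wderiv i))
          ((hG i).integrable_fun_mul ((hφ.pderiv i).memLp 2 _))]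
        simp only [Pi.sub_apply, mul_sub]
      simp only [e0, e1, Finset.sum_sub_distrib]
      linarith [h φ hφ]
    calc ‖T‖ₑ ≤ ‖∫ x in U, G₀ x * (f - φ) x‖ₑ
          + ∑ i, ‖∫ x in U, G i x * (wderiv U i f - pderiv i φ) x‖ₑ := by
          rw [e]
          exact (enorm_add_le _ _).trans (add_le_add le_rfl (enorm_sum_le _ _))
      _ ≤ normL2 U G₀ * ε + ∑ i, normL2 U (G i) * ε := by
          refine add_le_add ?_ (Finset.sum_le_sum fun i _ => ?_)
          · exact (enorm_integral_mul_le hG₀ m0).trans (by unfold normL2 at *; gcongr)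
          · exact (enorm_integral_mul_le (hG i) (m1 i)).trans
              (by have := (a1 i).le; unfold normL2 at *; gcongr)
      _ = K * ε := by rw [← Finset.sum_mul, ← add_mul]
  rw [← enorm_eq_zero]
  refine le_antisymm (le_of_forall_gt fun δ hδ => ?_) zero_le
  obtain ⟨ε, hε, hlt⟩ := ENNReal.exists_pos_mul_lt hKfin hδ.ne'
  exact (hle ε (by exact_mod_cast hε)).trans_lt (by rwa [mul_comm] at hlt)

/-- For a bounded `C¹` field `β` of constant divergence `κ`, every `f ∈ H¹₀(U)` satisfies
`κ ∫ f² + 2 ∫ f β·∇f = 0`. -/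
theorem MemH10.integral_sq_add_convection (hU : IsOpen U) (hf : MemH10 U f)
    {β : Fin 2 → Plane → ℝ} (hβ : ∀ i, ContDiffOn ℝ 1 (β i) U)
    (hβm : ∀ i, MemLp (β i) ∞ (volume.restrict U)) {κ : ℝ}
    (hκ : ∀ x ∈ U, ∑ i, pderiv i (β i) x = κ) :
    κ * (∫ x in U, f x ^ 2) + 2 * ∑ i, ∫ x in U, β i x * (f x * wderiv U i f x) = 0 := by
  have hL : ∀ (u : Plane → ℝ) (w : Fin 2 → Plane → ℝ), MemLp u 2 (volume.restrict U) →
      (∀ i, MemLp (w i) 2 (volume.restrict U)) →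
      MemLp (fun x => κ * u x + ∑ i, β i x * w i x) 2 (volume.restrict U) := fun u w hu hw =>
    (hu.const_mul κ).add (memLp_finsetSum _ fun i _ => (hβm i).top_mul_two (hw i))
  -- The identity is polarized so that it is linear in each argument: for test functions it says
  -- that the integral of `div(β φ ψ)` vanishes. The density argument is then applied to `ψ` and
  -- afterwards to `φ`.
  have key : ∀ φ ψ, IsTest U φ → IsTest U ψ →
      (∫ x in U, (κ * φ x + ∑ i, β i x * pderiv i φ x) * ψ x)
        + ∑ i, ∫ x in U, (β i x * φ x) * pderiv i ψ x = 0 := by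
    intro φ ψ hφ hψ
    have hφψ := hφ.mul hψ
    have i1 : ∀ i, IntegrableOn (fun x => β i x * pderiv i (fun y => φ y * ψ y) x) U := fun i =>
      ((hφψ.pderiv i).integrable_mul hU (hβ i).continuousOn).integrableOn
    have i2 : ∀ i, IntegrableOn (fun x => pderiv i (β i) x * (φ x * ψ x)) U := fun i =>
      (hφψ.integrable_mul hU (((hβ i).continuousOn_fderiv_of_isOpen hU le_rfl).clm_apply
        continuousOn_const)).integrableOn
    have i3 : ∀ i, IntegrableOn (fun x => (β i x * φ x) * pderiv i ψ x) U := fun i =>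
      ((hβm i).top_mul_two (hφ.memLp 2 _)).integrable_fun_mul ((hψ.pderiv i).memLp 2 _)
    have i4 : IntegrableOn (fun x => (κ * φ x + ∑ i, β i x * pderiv i φ x) * ψ x) U := by
      exact (hL φ _ (hφ.memLp 2 _) fun i => (hφ.pderiv i).memLp 2 _).integrable_fun_mul
        (hψ.memLp 2 _)
    have hs := Finset.sum_congr rfl fun i (_ : i ∈ Finset.univ) =>
      hφψ.setIntegral_mul_pderiv hU (hβ i) i
    rw [Finset.sum_neg_distrib, ← integral_finsetSum _ fun i _ => i1 i,
      ← integral_finsetSum _ fun i _ => i2 i] at hs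
    rw [← integral_finsetSum _ fun i _ => i3 i, ← integral_add i4
      (integrable_finsetSum _ fun i _ => i3 i)]
    rw [eq_neg_iff_add_eq_zero, ← integral_add (integrable_finsetSum _ fun i _ => i1 i)
      (integrable_finsetSum _ fun i _ => i2 i)] at hs
    rw [← hs]
    refine setIntegral_congr_fun hU.measurableSet fun x hx => ?_
    have hp := fun i => pderiv_mul (hφ.differentiable x) (hψ.differentiable x) i
    simp only [hp, ← Finset.sum_mul, hκ x hx]
    simp only [Fin.sum_univ_two]
    ring
  have key₂ : ∀ φ, IsTest U φ →
      (∫ x in U, (κ * f x + ∑ i, β i x * wderiv U i f x) * φ x)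
        + ∑ i, ∫ x in U, (β i x * f x) * pderiv i φ x = 0 := by
    intro φ hφ
    have h0 := hL φ _ (hφ.memLp 2 _) fun i => (hφ.pderiv i).memLp 2 _
    have h1 := fun i => (hβm i).top_mul_two (hφ.memLp 2 (volume.restrict U))
    have h := hf.integral_eq_zero h0 h1 fun ψ hψ => key φ ψ hφ hψ
    rw [← integral_finsetSum _ fun i _ => (h1 i).integrable_fun_mul (hf.1.memLp_wderiv i),
      ← integral_add (h0.integrable_fun_mul hf.1.1) (integrable_finsetSum _ fun i _ =>
        (h1 i).integrable_fun_mul (hf.1.memLp_wderiv i))] at h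
    have h0' := hL f _ hf.1.1 hf.1.memLp_wderiv
    have h1' := fun i => (hβm i).top_mul_two hf.1.1
    rw [← integral_finsetSum _ fun i _ =>
        (h1' i).integrable_fun_mul ((hφ.pderiv i).memLp 2 _),
      ← integral_add (h0'.integrable_fun_mul (hφ.memLp 2 _)) (integrable_finsetSum _ fun i _ =>
        (h1' i).integrable_fun_mul ((hφ.pderiv i).memLp 2 _)), ← h]
    refine integral_congr_ae (.of_forall fun x => ?_)
    simp only [Fin.sum_univ_two]
    ring
  have h0 := hL f _ hf.1.1 hf.1.memLp_wderiv
  have h1 := fun i => (hβm i).top_mul_two hf.1.1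
  have h := hf.integral_eq_zero h0 h1 key₂
  have i1 : ∀ i, IntegrableOn (fun x => β i x * (f x * wderiv U i f x)) U := fun i => by
    simpa only [mul_assoc, IntegrableOn] using (h1 i).integrable_fun_mul (hf.1.memLp_wderiv i)
  rw [← integral_finsetSum _ fun i _ => (h1 i).integrable_fun_mul (hf.1.memLp_wderiv i),
    ← integral_add (h0.integrable_fun_mul hf.1.1) (integrable_finsetSum _ fun i _ =>
        (h1 i).integrable_fun_mul (hf.1.memLp_wderiv i))] at h
  rw [← integral_finsetSum _ fun i _ => i1 i, ← integral_const_mul, ← integral_const_mul,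
    ← integral_add (hf.1.1.integrable_sq.const_mul κ)
      ((integrable_finsetSum _ fun i _ => i1 i).const_mul 2), ← h]
  refine integral_congr_ae (.of_forall fun x => ?_)
  simp only [Fin.sum_univ_two]
  ring

end ADR

namespace ADR

variable {U W : Set Plane} {f g : Plane → ℝ}

/-! ### The Poincaré inequality -/

theorem normL2_eq (hf : MemLp f 2 (volume.restrict U)) :
    normL2 U f = ENNReal.ofReal (√(∫ x in U, f x ^ 2)) := by
  rw [normL2, hf.eLpNorm_eq_integral_rpow_norm two_ne_zero ENNReal.ofNat_ne_top,
    Real.sqrt_eq_rpow]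
  norm_num

theorem pderiv_coord_sub_const (a : ℝ) (i : Fin 2) (x : Plane) :
    pderiv i (fun y => y 0 - a) x = if i = 0 then 1 else 0 := by
  have h : HasFDerivAt (fun y : Plane => y 0 - a) (EuclideanSpace.proj 0 : Plane →L[ℝ] ℝ) x :=
    (EuclideanSpace.proj 0 : Plane →L[ℝ] ℝ).hasFDerivAt.sub_const a
  rw [pderiv, h.fderiv]
  simp [eq_comm]

/-- The Poincaré inequality in a slab of width `h`. -/
theorem MemH10.poincare (hU : IsOpen U) (hf : MemH10 U f) {a h : ℝ}
    (ha : ∀ x ∈ U, |x 0 - a| ≤ h / 2) :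
    ∫ x in U, f x ^ 2 ≤ h ^ 2 * ∫ x in U, wderiv U 0 f x ^ 2 := by
  -- This field has divergence 1 and is bounded by `h / 2` on the slab, so `∫ f² = -2 ∫ f β·∇f` and
  -- the right side involves only the derivative across the slab.
  set β : Fin 2 → Plane → ℝ := ![fun x => x 0 - a, fun _ => 0] with hβdef
  have hβ0 : ContDiff ℝ 1 (fun x : Plane => x 0 - a) :=
    (EuclideanSpace.proj 0 : Plane →L[ℝ] ℝ).contDiff.sub contDiff_const
  have hβ : ∀ i, ContDiffOn ℝ 1 (β i) U := by
    intro i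
    fin_cases i
    · exact hβ0.contDiffOn
    · exact contDiffOn_const
  have hβm : ∀ i, MemLp (β i) ⊤ (volume.restrict U) := by
    intro i
    fin_cases i
    · refine memLp_top_of_bound hβ0.continuous.aestronglyMeasurable (h / 2) ?_
      filter_upwards [ae_restrict_mem hU.measurableSet] with x hx using ha x hx
    · exact MemLp.zero'
  have hκ : ∀ x ∈ U, ∑ i, pderiv i (β i) x = 1 := by
    intro x _
    have h0 : pderiv 0 (β 0) x = 1 := (pderiv_coord_sub_const a 0 x).trans (if_pos rfl)
    have h1 : pderiv 1 (β 1) x = 0 := by simp [pderiv, hβdef]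
    rw [Fin.sum_univ_two, h0, h1, add_zero]
  have key := hf.integral_sq_add_convection hU hβ hβm hκ
  have e1 : ∫ x in U, β 1 x * (f x * wderiv U 1 f x) = 0 := by simp [hβdef]
  rw [Fin.sum_univ_two, e1, add_zero, one_mul] at key
  have hw := hf.1.memLp_wderiv 0
  have hfx : IntegrableOn (fun x => f x * (β 0 x * wderiv U 0 f x)) U :=
    hf.1.1.integrable_fun_mul ((hβm 0).top_mul_two hw)
  have hle : -(2 * ∫ x in U, β 0 x * (f x * wderiv U 0 f x))
      ≤ (1 / 2) * (∫ x in U, f x ^ 2) + (h ^ 2 / 2) * ∫ x in U, wderiv U 0 f x ^ 2 := by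
    rw [← integral_const_mul, ← integral_const_mul, ← integral_const_mul, ← integral_neg,
      ← integral_add (hf.1.1.integrable_sq.const_mul _) (hw.integrable_sq.const_mul _)]
    refine setIntegral_mono_on ?_ ((hf.1.1.integrable_sq.const_mul _).add
      (hw.integrable_sq.const_mul _)) hU.measurableSet fun x hx => ?_
    · refine ((hfx.const_mul 2).neg).congr (.of_forall fun x => ?_)
      simp only [Pi.neg_apply]
      ring
    · have hb : β 0 x ^ 2 ≤ (h / 2) ^ 2 := sq_le_sq' (abs_le.1 (ha x hx)).1 (abs_le.1 (ha x hx)).2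
      have hc := mul_le_mul_of_nonneg_right hb (sq_nonneg (wderiv U 0 f x))
      -- Young's inequality `-2 f β w ≤ f²/2 + 2 β² w²`, with weights chosen so that half of `∫ f²`
      -- can be absorbed on the left and `β² ≤ h²/4` leaves the constant `h²`.
      nlinarith [sq_nonneg (f x + 2 * (β 0 x * wderiv U 0 f x))]
  linarith

/-! ### Functions that are affine on an open set -/

section Affine

variable {A : Plane →ᵃ[ℝ] ℝ} {v : Plane → ℝ}

theorem contDiff_affineMap (A : Plane →ᵃ[ℝ] ℝ) {m : ℕ∞ω} : ContDiff ℝ m A :=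
  (⟨A, A.continuous_of_finiteDimensional⟩ : Plane →ᴬ[ℝ] ℝ).contDiff

theorem pderiv_affineMap (A : Plane →ᵃ[ℝ] ℝ) (i : Fin 2) (x : Plane) :
    pderiv i A x = A.linear (EuclideanSpace.single i 1) := by
  have h : HasFDerivAt A (LinearMap.toContinuousLinearMap A.linear) x := by
    have h' := (LinearMap.toContinuousLinearMap A.linear).hasFDerivAt (x := x)
    rw [AffineMap.decomp A]
    exact h'.add_const (A 0)
  rw [pderiv, h.fderiv]
  rfl

theorem pderiv_eq_of_eqOn_affine (hU : IsOpen U) (hv : Set.EqOn v A U) (i : Fin 2) {x : Plane}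
    (hx : x ∈ U) : pderiv i v x = A.linear (EuclideanSpace.single i 1) := by
  rw [← pderiv_affineMap A i x, pderiv, pderiv,
    (hv.eventuallyEq_of_mem (hU.mem_nhds hx)).fderiv_eq]

theorem hasWeakPartial_of_eqOn_affine (hU : IsOpen U) (hfin : volume U ≠ ⊤)
    (hv : Set.EqOn v A U) (i : Fin 2) :
    HasWeakPartial U i v fun _ => A.linear (EuclideanSpace.single i 1) := by
  have : IsFiniteMeasure (volume.restrict U) := isFiniteMeasure_restrict.2 hfin
  refine ⟨memLp_const _, fun φ hφ => ?_⟩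
  rw [hφ.setIntegral_mul_pderiv hU ((contDiff_affineMap A).contDiffOn.congr hv)]
  congr 1
  exact setIntegral_congr_fun hU.measurableSet fun x hx => by
    simp only [pderiv_eq_of_eqOn_affine hU hv i hx]

/-- If `v` is affine on `U` and `v - d ∈ H¹₀(U)`, then `‖∂ᵢ(v - d)‖ ≤ ‖∂ᵢd‖` in `L²(U)`. -/
theorem integral_sq_wderiv_sub_affine_le (hU : IsOpen U) (hfin : volume U ≠ ⊤)
    (hv : Set.EqOn v A U) (hv1 : MemH1 U v) {d : Plane → ℝ} (hd : MemH1 U d)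
    (h : MemH10 U (v - d)) (i : Fin 2) :
    ∫ x in U, wderiv U i (v - d) x ^ 2 ≤ ∫ x in U, wderiv U i d x ^ 2 := by
  have : IsFiniteMeasure (volume.restrict U) := isFiniteMeasure_restrict.2 hfin
  set p := A.linear (EuclideanSpace.single i 1)
  have hη := h.1.memLp_wderiv i
  have hsum : ∀ w : Fin 2 → Plane → ℝ,
      ∑ j, ∫ x in U, (if j = i then (1 : ℝ) else 0) * w j x = ∫ x in U, w i x := fun w => by
    rw [Finset.sum_eq_single i (fun j _ hj => by simp [hj]) (by simp)]
    simp
  -- The identity `∫ ∂ᵢφ = 0` for test functions, extended to `H¹₀`.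
  have hmean : ∫ x in U, wderiv U i (v - d) x = 0 := by
    have := h.integral_eq_zero (G₀ := fun _ => 0) (G := fun j _ => if j = i then 1 else 0)
      (memLp_const 0) (fun j => memLp_const _) fun φ hφ => by
        have := hφ.setIntegral_mul_pderiv hU (contDiffOn_const (c := (1 : ℝ))) i
        have h1 : ∀ x, pderiv i (fun _ => (1 : ℝ)) x = 0 := fun x => by simp [pderiv]
        simp only [h1, one_mul, zero_mul, integral_zero, neg_zero] at this
        rw [hsum fun j => pderiv j φ, this]
        simp
    rw [hsum fun j => wderiv U j (v - d)] at this
    simpa using this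
  have hae : ∀ᵐ x ∂volume.restrict U, wderiv U i d x = p - wderiv U i (v - d) x := by
    filter_upwards [hv1.wderiv_sub hU hd i,
      (hasWeakPartial_of_eqOn_affine hU hfin hv i).wderiv_ae_eq hU] with x h1 h2
    rw [h1, Pi.sub_apply, h2]
    ring
  -- With `∂ᵢv = p` constant, the cross term vanishes by the zero mean, so `‖∂ᵢd‖² = ‖p‖² + ‖∂ᵢ(v -
  -- d)‖²`.
  have hsq : ∫ x in U, wderiv U i d x ^ 2
      = ∫ x in U, (p ^ 2 - 2 * p * wderiv U i (v - d) x + wderiv U i (v - d) x ^ 2) := by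
    refine integral_congr_ae ?_
    filter_upwards [hae] with x hx
    rw [hx]
    ring
  have hη1 : Integrable (wderiv U i (v - d)) (volume.restrict U) := hη.integrable one_le_two
  have hlin : Integrable (fun x => p ^ 2 - 2 * p * wderiv U i (v - d) x) (volume.restrict U) :=
    (integrable_const _).sub (hη1.const_mul _)
  rw [hsq, integral_add hlin hη.integrable_sq,
    integral_sub (integrable_const _) (hη1.const_mul _), integral_const_mul, hmean]
  have : 0 ≤ ∫ _ in U, p ^ 2 := integral_nonneg fun _ => sq_nonneg p
  linarith

end Affine

/-! ### Geometry of a triangulation -/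

namespace Triangulation

variable {Ω : Set Plane} {n : ℕ} (M : Triangulation Ω n)

theorem isCompact_cell (k : Fin n) : IsCompact (M.cell k) :=
  (Set.finite_range (M.vertex k)).isCompact_convexHull ℝ

theorem isOpen_elem (k : Fin n) : IsOpen (M.elem k) := isOpen_interior

theorem elem_subset (k : Fin n) : M.elem k ⊆ Ω := M.interior_subset k

theorem volume_elem_ne_top (k : Fin n) : volume (M.elem k) ≠ ⊤ :=
  ((measure_mono _root_.interior_subset).trans_lt (M.isCompact_cell k).measure_lt_top).ne

/-- Centring at the midpoint of the range of `x 0` gives half the diameter, which makes the Poincaré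
constant exactly `h_k`. -/
theorem exists_slab (k : Fin n) : ∃ a : ℝ, ∀ x ∈ M.elem k, |x 0 - a| ≤ M.diam k / 2 := by
  have hne : (M.cell k).Nonempty := ⟨_, subset_convexHull ℝ _ (Set.mem_range_self 0)⟩
  have hc : ContinuousOn (fun x : Plane => x 0) (M.cell k) := by fun_prop
  obtain ⟨y, hy, hymin⟩ := (M.isCompact_cell k).exists_isMinOn hne hc
  obtain ⟨z, hz, hzmax⟩ := (M.isCompact_cell k).exists_isMaxOn hne hc
  have hyz : z 0 - y 0 ≤ M.diam k := by
    refine le_trans ?_ (Metric.dist_le_diam_of_mem (M.isCompact_cell k).isBounded hz hy)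
    rw [dist_eq_norm]
    exact (le_abs_self _).trans (PiLp.norm_apply_le (z - y) 0)
  refine ⟨(y 0 + z 0) / 2, fun x hx => abs_le.2 ?_⟩
  have h1 : y 0 ≤ x 0 := hymin (_root_.interior_subset hx)
  have h2 : x 0 ≤ z 0 := hzmax (_root_.interior_subset hx)
  constructor <;> linarith

/-- What the open triangles miss lies on boundaries of convex sets, which are null. -/
theorem iUnion_elem_ae_eq : (⋃ k, M.elem k) =ᵐ[volume] Ω := by
  refine Filter.EventuallyLE.antisymm
    (LE.le.eventuallyLE (Set.iUnion_subset M.elem_subset)) ?_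
  rw [ae_le_set]
  refine measure_mono_null (t := ⋃ k, frontier (M.cell k)) ?_
    (measure_iUnion_null fun k => (convex_convexHull ℝ _).addHaar_frontier volume)
  rintro x ⟨hx, hx'⟩
  have hcl : x ∈ ⋃ k, M.cell k := M.cover ▸ subset_closure hx
  obtain ⟨k, hk⟩ := Set.mem_iUnion.1 hcl
  exact Set.mem_iUnion.2 ⟨k, subset_closure hk, fun h => hx' (Set.mem_iUnion.2 ⟨k, h⟩)⟩

theorem setIntegral_eq_sum (hf : IntegrableOn f Ω) :
    ∫ x in Ω, f x = ∑ k, ∫ x in M.elem k, f x := by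
  rw [← setIntegral_congr_set M.iUnion_elem_ae_eq]
  exact integral_iUnion_fintype (fun k => (M.isOpen_elem k).measurableSet) M.disjoint
    fun k => hf.mono_set (M.elem_subset k)

theorem MemVh.sub {M : Triangulation Ω n} (hΩ : IsOpen Ω) (hf : M.MemVh f) (hg : M.MemVh g) :
    M.MemVh (f - g) := by
  refine ⟨hf.1.sub hΩ hg.1, hf.2.1.sub hg.2.1, fun k => ?_⟩
  obtain ⟨A, hA⟩ := hf.2.2 k
  obtain ⟨B, hB⟩ := hg.2.2 k
  exact ⟨A - B, fun x hx => by simp [hA hx, hB hx]⟩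

end Triangulation

/-! ### The energy norm and the interpolation constants -/

section Energy

variable {Ω : Set Plane} {D b : Fin 2 → Plane → ℝ} {μ : ℝ} {c d : Plane → ℝ}

theorem integrableOn_diffusion (hDm : ∀ i, MemLp (D i) ⊤ (volume.restrict Ω)) (hc : MemH1 Ω c)
    (hd : MemH1 Ω d) (i : Fin 2) :
    IntegrableOn (fun x => D i x * wderiv Ω i c x * wderiv Ω i d x) Ω :=
  ((hDm i).top_mul_two (hc.memLp_wderiv i)).integrable_fun_mul (hd.memLp_wderiv i)

theorem integrableOn_convection (hbm : ∀ i, MemLp (b i) ⊤ (volume.restrict Ω)) (hc : MemH1 Ω c)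
    (hd : MemH1 Ω d) : IntegrableOn (fun x => d x * ∑ i, b i x * wderiv Ω i c x) Ω :=
  hd.1.integrable_fun_mul
    (memLp_finsetSum _ fun i _ => (hbm i).top_mul_two (hc.memLp_wderiv i))

theorem integrableOn_reaction (μ : ℝ) (hc : MemH1 Ω c) (hd : MemH1 Ω d) :
    IntegrableOn (fun x => μ * c x * d x) Ω :=
  (hc.1.const_mul μ).integrable_fun_mul hd.1

/-- The integrand of the bilinear form. -/
noncomputable def formDensity (Ω : Set Plane) (D b : Fin 2 → Plane → ℝ) (μ : ℝ) (c d : Plane → ℝ)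
    (x : Plane) : ℝ :=
  (∑ i, D i x * wderiv Ω i c x * wderiv Ω i d x) + d x * (∑ i, b i x * wderiv Ω i c x)
    + μ * c x * d x

theorem integrableOn_formDensity (hDm : ∀ i, MemLp (D i) ⊤ (volume.restrict Ω))
    (hbm : ∀ i, MemLp (b i) ⊤ (volume.restrict Ω)) (hc : MemH1 Ω c) (hd : MemH1 Ω d) :
    IntegrableOn (formDensity Ω D b μ c d) Ω :=
  ((integrable_finsetSum _ fun i _ => integrableOn_diffusion hDm hc hd i).add
    (integrableOn_convection hbm hc hd)).add (integrableOn_reaction μ hc hd)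

theorem aForm_eq_integral (hDm : ∀ i, MemLp (D i) ⊤ (volume.restrict Ω))
    (hbm : ∀ i, MemLp (b i) ⊤ (volume.restrict Ω)) (hc : MemH1 Ω c) (hd : MemH1 Ω d) :
    aForm Ω D b μ c d = ∫ x in Ω, formDensity Ω D b μ c d x := by
  have hs := integrable_finsetSum Finset.univ fun i _ => integrableOn_diffusion hDm hc hd i
  have hsc : Integrable (fun x => (∑ i, D i x * wderiv Ω i c x * wderiv Ω i d x)
      + d x * ∑ i, b i x * wderiv Ω i c x) (volume.restrict Ω) :=
    hs.add (integrableOn_convection hbm hc hd)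
  rw [aForm, ← integral_finsetSum _ fun i _ => integrableOn_diffusion hDm hc hd i,
    ← integral_add hs (integrableOn_convection hbm hc hd),
    ← integral_add hsc (integrableOn_reaction μ hc hd)]
  rfl

theorem aForm_sub_left (hΩ : IsOpen Ω) (hDm : ∀ i, MemLp (D i) ⊤ (volume.restrict Ω))
    (hbm : ∀ i, MemLp (b i) ⊤ (volume.restrict Ω)) {c' : Plane → ℝ} (hc : MemH1 Ω c)
    (hc' : MemH1 Ω c') (hd : MemH1 Ω d) :
    aForm Ω D b μ (c - c') d = aForm Ω D b μ c d - aForm Ω D b μ c' d := by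
  rw [aForm_eq_integral hDm hbm (hc.sub hc') hd, aForm_eq_integral hDm hbm hc hd,
    aForm_eq_integral hDm hbm hc' hd, ← integral_sub (integrableOn_formDensity hDm hbm hc hd)
      (integrableOn_formDensity hDm hbm hc' hd)]
  refine integral_congr_ae ?_
  filter_upwards [hc.wderiv_sub hΩ hc' 0, hc.wderiv_sub hΩ hc' 1] with x h0 h1
  simp only [formDensity, Fin.sum_univ_two, h0, h1, Pi.sub_apply]
  ring

theorem aForm_sub_right (hΩ : IsOpen Ω) (hDm : ∀ i, MemLp (D i) ⊤ (volume.restrict Ω))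
    (hbm : ∀ i, MemLp (b i) ⊤ (volume.restrict Ω)) {d' : Plane → ℝ} (hc : MemH1 Ω c)
    (hd : MemH1 Ω d) (hd' : MemH1 Ω d') :
    aForm Ω D b μ c (d - d') = aForm Ω D b μ c d - aForm Ω D b μ c d' := by
  rw [aForm_eq_integral hDm hbm hc (hd.sub hd'), aForm_eq_integral hDm hbm hc hd,
    aForm_eq_integral hDm hbm hc hd', ← integral_sub (integrableOn_formDensity hDm hbm hc hd)
      (integrableOn_formDensity hDm hbm hc hd')]
  refine integral_congr_ae ?_
  filter_upwards [hd.wderiv_sub hΩ hd' 0, hd.wderiv_sub hΩ hd' 1] with x h0 h1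
  simp only [formDensity, Fin.sum_univ_two, h0, h1, Pi.sub_apply]
  ring

theorem integrableOn_energyDensity (hDm : ∀ i, MemLp (D i) ⊤ (volume.restrict Ω)) (μ : ℝ)
    (hd : MemH1 Ω d) :
    IntegrableOn (fun x => (∑ i, D i x * wderiv Ω i d x ^ 2) + μ * d x ^ 2) Ω := by
  refine Integrable.add (integrable_finsetSum _ fun i _ => ?_) (hd.1.integrable_sq.const_mul μ)
  simpa only [pow_two, mul_assoc, IntegrableOn] using integrableOn_diffusion hDm hd hd i

theorem energyDensity_nonneg (hD : ∀ i, ∀ x ∈ Ω, 0 ≤ D i x) (hμ : 0 ≤ μ) (d : Plane → ℝ)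
    {x : Plane} (hx : x ∈ Ω) : 0 ≤ (∑ i, D i x * wderiv Ω i d x ^ 2) + μ * d x ^ 2 :=
  add_nonneg (Finset.sum_nonneg fun i _ => mul_nonneg (hD i x hx) (sq_nonneg _))
    (mul_nonneg hμ (sq_nonneg _))

/-- For a solenoidal velocity the convective part of `a(d,d)` vanishes. -/
theorem MemH10.aForm_self (hΩ : IsOpen Ω) (hDm : ∀ i, MemLp (D i) ⊤ (volume.restrict Ω))
    (hb : ∀ i, ContDiffOn ℝ 1 (b i) Ω) (hbm : ∀ i, MemLp (b i) ⊤ (volume.restrict Ω))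
    (hdiv : ∀ x ∈ Ω, ∑ i, pderiv i (b i) x = 0) (hd : MemH10 Ω d) :
    aForm Ω D b μ d d = ∫ x in Ω, (∑ i, D i x * wderiv Ω i d x ^ 2) + μ * d x ^ 2 := by
  have i1 : ∀ i, IntegrableOn (fun x => b i x * (d x * wderiv Ω i d x)) Ω := fun i => by
    simpa only [mul_assoc, IntegrableOn] using
      ((hbm i).top_mul_two hd.1.1).integrable_fun_mul (hd.1.memLp_wderiv i)
  have hconv : ∫ x in Ω, d x * ∑ i, b i x * wderiv Ω i d x = 0 := by
    have h := hd.integral_sq_add_convection hΩ hb hbm hdiv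
    rw [← integral_finsetSum _ fun i _ => i1 i] at h
    rw [← (mul_eq_zero.1 (by linarith)).resolve_left (two_ne_zero (α := ℝ))]
    refine integral_congr_ae (.of_forall fun x => ?_)
    simp only [Fin.sum_univ_two]
    ring
  have i2 := integrable_finsetSum Finset.univ fun i _ => integrableOn_diffusion hDm hd.1 hd.1 i
  rw [aForm, hconv, add_zero, ← integral_finsetSum _ fun i _ =>
      integrableOn_diffusion hDm hd.1 hd.1 i,
    ← integral_add i2 (integrableOn_reaction μ hd.1 hd.1)]
  simp only [pow_two, mul_assoc]

theorem MemH10.localEnergyNorm_le (hΩ : IsOpen Ω) (hUΩ : U ⊆ Ω)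
    (hDm : ∀ i, MemLp (D i) ⊤ (volume.restrict Ω)) (hD : ∀ i, ∀ x ∈ Ω, 0 ≤ D i x)
    (hb : ∀ i, ContDiffOn ℝ 1 (b i) Ω) (hbm : ∀ i, MemLp (b i) ⊤ (volume.restrict Ω))
    (hdiv : ∀ x ∈ Ω, ∑ i, pderiv i (b i) x = 0) (hμ : 0 ≤ μ) (hd : MemH10 Ω d) :
    localEnergyNorm Ω D μ U d ≤ energyNorm Ω D b μ d := by
  refine Real.sqrt_le_sqrt ?_
  rw [hd.aForm_self hΩ hDm hb hbm hdiv]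
  refine setIntegral_mono_set (integrableOn_energyDensity hDm μ hd.1) ?_ hUΩ.eventuallyLE
  filter_upwards [ae_restrict_mem hΩ.measurableSet] with x hx using energyDensity_nonneg hD hμ d hx

/-- The interpolation estimate on one element. -/
theorem Triangulation.normL2_interpolation_error_le {n : ℕ} (M : Triangulation Ω n)
    (hDm : ∀ i, MemLp (D i) ⊤ (volume.restrict Ω)) {D₀ : ℝ} (hD₀ : 0 < D₀)
    (hD : ∀ i, ∀ x ∈ Ω, D₀ ≤ D i x) (hμ : 0 ≤ μ) {dh : Plane → ℝ} (hd : MemH1 Ω d)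
    (hdh : M.MemVh dh) (k : Fin n) (hη : MemH10 (M.elem k) (dh - d)) :
    normL2 (M.elem k) (dh - d) ≤
      ENNReal.ofReal (1 / √D₀) * ENNReal.ofReal (M.diam k * localEnergyNorm Ω D μ (M.elem k) d) := by
  have hU := M.isOpen_elem k
  have hUΩ := M.elem_subset k
  obtain ⟨A, hA⟩ := hdh.2.2 k
  obtain ⟨a, ha⟩ := M.exists_slab k
  have hP := hη.poincare hU ha
  have hI := integral_sq_wderiv_sub_affine_le hU (M.volume_elem_ne_top k)
    (hA.mono _root_.interior_subset) (hdh.1.1.mono hUΩ) (hd.mono hUΩ) hη 0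
  have hE : D₀ * ∫ x in M.elem k, wderiv (M.elem k) 0 d x ^ 2
      ≤ ∫ x in M.elem k, (∑ i, D i x * wderiv Ω i d x ^ 2) + μ * d x ^ 2 := by
    rw [← integral_const_mul]
    refine integral_mono_ae (((hd.mono hUΩ).memLp_wderiv 0).integrable_sq.const_mul D₀)
      ((integrableOn_energyDensity hDm μ hd).mono_set hUΩ) ?_
    filter_upwards [hd.wderiv_ae_eq_of_subset hU hUΩ 0, ae_restrict_mem hU.measurableSet]
      with x h0 hx
    have hx := hUΩ hx
    simp only [Fin.sum_univ_two, ← h0]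
    have h1 := mul_le_mul_of_nonneg_right (hD 0 x hx) (sq_nonneg (wderiv Ω 0 d x))
    have h2 := mul_nonneg (hD₀.le.trans (hD 1 x hx)) (sq_nonneg (wderiv Ω 1 d x))
    have h3 := mul_nonneg hμ (sq_nonneg (d x))
    linarith
  rw [← ENNReal.ofReal_mul (by positivity), normL2_eq hη.1.1]
  refine ENNReal.ofReal_le_ofReal ?_
  have hdiam : 0 ≤ M.diam k := Metric.diam_nonneg
  rw [one_div_mul_eq_div, le_div_iff₀ (Real.sqrt_pos.2 hD₀), localEnergyNorm,
    ← Real.sqrt_mul' _ hD₀.le]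
  conv_rhs => rw [← Real.sqrt_sq hdiam]
  rw [← Real.sqrt_mul (sq_nonneg _)]
  refine Real.sqrt_le_sqrt ?_
  calc (∫ x in M.elem k, (dh - d) x ^ 2) * D₀
      ≤ (M.diam k ^ 2 * ∫ x in M.elem k, wderiv (M.elem k) 0 d x ^ 2) * D₀ := by
        refine mul_le_mul_of_nonneg_right (hP.trans ?_) hD₀.le
        exact mul_le_mul_of_nonneg_left hI (sq_nonneg _)
    _ = M.diam k ^ 2 * (D₀ * ∫ x in M.elem k, wderiv (M.elem k) 0 d x ^ 2) := by ring
    _ ≤ _ := mul_le_mul_of_nonneg_left hE (sq_nonneg _)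

/-- The contribution of an open set `U` on which `ch` is affine to the residual functional. -/
theorem enorm_integral_residual_le (hU : IsOpen U) (hUΩ : U ⊆ Ω)
    (hfin : volume U ≠ ⊤) (hD : ∀ i, ContDiffOn ℝ 1 (D i) Ω)
    (hDm : ∀ i, MemLp (D i) ⊤ (volume.restrict Ω))
    (hbm : ∀ i, MemLp (b i) ⊤ (volume.restrict Ω)) {q ch η : Plane → ℝ}
    (hq : MemLp q 2 (volume.restrict Ω)) (hch : MemH1 Ω ch) {A : Plane →ᵃ[ℝ] ℝ}
    (hA : Set.EqOn ch A U) (hηΩ : MemH1 Ω η) (hη : MemH10 U η) :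
    ‖∫ x in U, (formDensity Ω D b μ ch η x - q x * η x)‖ₑ
      ≤ normL2 U (residual D b μ q ch) * normL2 U η := by
  have : IsFiniteMeasure (volume.restrict U) := isFiniteMeasure_restrict.2 hfin
  have hmono := Measure.restrict_mono hUΩ (le_refl (volume : Measure Plane))
  have hp : ∀ i, ∀ x ∈ U, pderiv i ch x = A.linear (EuclideanSpace.single i 1) := fun i x hx =>
    pderiv_eq_of_eqOn_affine hU hA i hx
  have hpm : ∀ i, MemLp (pderiv i ch) 2 (volume.restrict U) := fun i =>
    (memLp_congr_ae (by
      filter_upwards [ae_restrict_mem hU.measurableSet] with x hx using hp i x hx)).2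
      (memLp_const (A.linear (EuclideanSpace.single i 1)))
  have hw : ∀ i, wderiv Ω i ch =ᵐ[volume.restrict U] pderiv i ch := fun i => by
    filter_upwards [hch.wderiv_ae_eq_of_subset hU hUΩ i,
      (hasWeakPartial_of_eqOn_affine hU hfin hA i).wderiv_ae_eq hU,
      ae_restrict_mem hU.measurableSet] with x h1 h2 hx
    rw [h1, h2, hp i x hx]
  have hF : ∀ i, ContDiffOn ℝ 1 (fun y => D i y * pderiv i ch y) U := fun i =>
    ((hD i).mono hUΩ).mul (contDiffOn_const.congr (hp i))
  have hFm : ∀ i, MemLp (fun y => D i y * pderiv i ch y) 2 (volume.restrict U) := fun i =>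
    ((hDm i).mono_measure hmono).top_mul_two (hpm i)
  -- The residual is `s - t`. The part `s` is always in `L²`, whereas the divergence `t` need not
  -- be, because the derivatives of `D` may be unbounded near the boundary of `Ω`.
  set s : Plane → ℝ := fun x => (∑ i, b i x * pderiv i ch x) + μ * ch x - q x with hs
  set t : Plane → ℝ := fun x => ∑ i, pderiv i (fun y => D i y * pderiv i ch y) x with ht
  have hr : residual D b μ q ch = fun x => s x - t x := by
    funext x
    simp only [residual, hs, ht]
    ring
  have hsm : MemLp s 2 (volume.restrict U) :=
    ((memLp_finsetSum _ fun i _ => ((hbm i).mono_measure hmono).top_mul_two (hpm i)).add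
      ((hch.1.mono_measure hmono).const_mul μ)).sub (hq.mono_measure hmono)
  have htc : ∀ i, ContinuousOn (pderiv i fun y => D i y * pderiv i ch y) U := fun i =>
    ((hF i).continuousOn_fderiv_of_isOpen hU le_rfl).clm_apply continuousOn_const
  have hX : ∫ x in U, (formDensity Ω D b μ ch η x - q x * η x)
      = (∫ x in U, s x * η x) + ∑ i, ∫ x in U, (D i x * pderiv i ch x) * wderiv U i η x := by
    rw [← integral_finsetSum _ fun i _ => (hFm i).integrable_fun_mul (hη.1.memLp_wderiv i),
      ← integral_add (hsm.integrable_fun_mul hη.1.1) (integrable_finsetSum _ fun i _ =>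
        (hFm i).integrable_fun_mul (hη.1.memLp_wderiv i))]
    refine integral_congr_ae ?_
    filter_upwards [hw 0, hw 1, hηΩ.wderiv_ae_eq_of_subset hU hUΩ 0,
      hηΩ.wderiv_ae_eq_of_subset hU hUΩ 1] with x h0 h1 h2 h3
    simp only [formDensity, hs, Fin.sum_univ_two, h0, h1, h2, h3]
    ring
  by_cases htop : normL2 U (residual D b μ q ch) = ⊤
  -- In `ℝ≥0∞` one has `⊤ * 0 = 0`, so an infinite residual norm does not make the bound trivial: if
  -- `η` vanishes almost everywhere, the left side must be shown to be zero.
  · by_cases hz : normL2 U η = 0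
    · have hη0 : η =ᵐ[volume.restrict U] 0 :=
        (eLpNorm_eq_zero_iff hη.1.1.1 two_ne_zero).1 hz
      have hwη : ∀ i, wderiv U i η =ᵐ[volume.restrict U] 0 := fun i => by
        refine HasWeakPartial.wderiv_ae_eq hU ⟨MemLp.zero, fun φ _ => ?_⟩
        rw [integral_eq_zero_of_ae, integral_eq_zero_of_ae, neg_zero]
        · exact .of_forall fun x => by simp
        · filter_upwards [hη0] with x hx
          simp [hx]
      have h0 : ∫ x in U, s x * η x = 0 := integral_eq_zero_of_ae (by
        filter_upwards [hη0] with x hx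
        simp [hx])
      have h1 : ∀ i, ∫ x in U, (D i x * pderiv i ch x) * wderiv U i η x = 0 := fun i =>
        integral_eq_zero_of_ae (by
          filter_upwards [hwη i] with x hx
          simp [hx])
      simp [hX, h0, h1]
    · rw [htop, ENNReal.top_mul hz]
      exact le_top
  · have hrm : MemLp (fun x => s x - t x) 2 (volume.restrict U) := by
      refine ⟨hsm.1.sub ((continuousOn_finsetSum _ fun i _ => htc i).aestronglyMeasurable
        hU.measurableSet), ?_⟩
      rw [← hr]
      exact lt_top_iff_ne_top.2 htop
    -- A residual in `L²` forces `t = s - (s - t)` into `L²`, and then integration by parts extends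
    -- from test functions to `η`.
    have htm : MemLp t 2 (volume.restrict U) := by
      have := hsm.sub hrm
      exact (memLp_congr_ae (.of_forall fun x => by simp)).1 this
    have hid := hη.integral_eq_zero htm hFm fun φ hφ => by
      have h1 : ∀ i, IntegrableOn (fun x => pderiv i (fun y => D i y * pderiv i ch y) x * φ x) U :=
        fun i => (hφ.integrable_mul hU (htc i)).integrableOn
      simp only [ht, Finset.sum_mul]
      rw [integral_finsetSum _ fun i _ => h1 i, ← Finset.sum_add_distrib]
      refine Finset.sum_eq_zero fun i _ => ?_
      rw [hφ.setIntegral_mul_pderiv hU (hF i), add_neg_cancel]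
    have hfinal : ∫ x in U, (formDensity Ω D b μ ch η x - q x * η x)
        = ∫ x in U, (s x - t x) * η x := by
      simp only [sub_mul]
      rw [hX, integral_sub (hsm.integrable_fun_mul hη.1.1) (htm.integrable_fun_mul hη.1.1)]
      linarith
    rw [hfinal, hr]
    exact enorm_integral_mul_le hrm hη.1.1

end Energy

end ADR

namespace ADR

/-! ### Bounds involving the interpolation constants -/

theorem memLp_top_of_contDiffOn {U : Set Plane} (hU : IsOpen U) {F : Plane → ℝ}
    (hF : ContDiffOn ℝ 1 F U) {B : ℝ} (hB : ∀ x ∈ U, |F x| ≤ B) :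
    MemLp F ⊤ (volume.restrict U) := by
  refine memLp_top_of_bound (hF.continuousOn.aestronglyMeasurable hU.measurableSet) B ?_
  filter_upwards [ae_restrict_mem hU.measurableSet] with x hx using hB x hx

section

variable {Ω : Set Plane} {n : ℕ} {M : Triangulation Ω n} {D b : Fin 2 → Plane → ℝ} {μ : ℝ}

theorem Triangulation.interpConst_le (hDm : ∀ i, MemLp (D i) ⊤ (volume.restrict Ω)) {D₀ : ℝ}
    (hD₀ : 0 < D₀) (hD : ∀ i, ∀ x ∈ Ω, D₀ ≤ D i x) (hμ : 0 ≤ μ) (k : Fin n) :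
    M.interpConst D μ k ≤ ENNReal.ofReal (1 / √D₀) := by
  refine iSup_le fun d => iSup_le fun dh => iSup_le fun hd => iSup_le fun hdh =>
    iSup_le fun hη => ?_
  exact ENNReal.div_le_of_le_mul
    (M.normL2_interpolation_error_le hDm hD₀ hD hμ hd.1 hdh.2.1 k (hη k))

theorem Triangulation.normL2_le_interpConst_mul (hDm : ∀ i, MemLp (D i) ⊤ (volume.restrict Ω))
    {D₀ : ℝ} (hD₀ : 0 < D₀) (hD : ∀ i, ∀ x ∈ Ω, D₀ ≤ D i x) (hμ : 0 ≤ μ) {d dh : Plane → ℝ}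
    (hd : MemH10 Ω d) (hdh : M.IsNodalInterpolant d dh) (hη : M.VanishesOnInterfaces (dh - d))
    (k : Fin n) :
    normL2 (M.elem k) (dh - d) ≤
      M.interpConst D μ k * ENNReal.ofReal (M.diam k * localEnergyNorm Ω D μ (M.elem k) d) := by
  set N := ENNReal.ofReal (M.diam k * localEnergyNorm Ω D μ (M.elem k) d) with hN
  -- A vanishing denominator forces a vanishing numerator, so the only degenerate quotient is `0 / 0
  -- = 0` and multiplying back is legitimate.
  have h0 : N = 0 → normL2 (M.elem k) (dh - d) = 0 := fun h => by
    simpa [← hN, h] using M.normL2_interpolation_error_le hDm hD₀ hD hμ hd.1 hdh.2.1 k (hη k)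
  calc normL2 (M.elem k) (dh - d) ≤ normL2 (M.elem k) (dh - d) / N * N := by
        by_cases h : N = 0
        · rw [h0 h]
          exact zero_le
        · exact (ENNReal.div_mul_cancel h ENNReal.ofReal_ne_top).ge
    _ ≤ M.interpConst D μ k * N := by
        gcongr
        exact le_iSup_of_le d (le_iSup_of_le dh (le_iSup_of_le hd (le_iSup_of_le hdh
          (le_iSup_of_le hη le_rfl))))

end

end ADR

/-! ### The a posteriori error estimate -/

theorem mainTheorem4
    -- the domain and its triangulation
    (Ω : Set ADR.Plane) (hΩ : IsOpen Ω) (n : ℕ) (M : ADR.Triangulation Ω n)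
    -- the data of the problem
    (D b : Fin 2 → ADR.Plane → ℝ) (μ : ℝ) (q : ADR.Plane → ℝ)
    (hD : ∀ i, ContDiffOn ℝ 1 (D i) Ω) (hDbdd : ∃ B : ℝ, ∀ i, ∀ x ∈ Ω, |D i x| ≤ B)
    (D₀ : ℝ) (hD₀ : 0 < D₀) (hDpos : ∀ i, ∀ x ∈ Ω, D₀ ≤ D i x)
    (hb : ∀ i, ContDiffOn ℝ 1 (b i) Ω) (hbbdd : ∃ B : ℝ, ∀ i, ∀ x ∈ Ω, |b i x| ≤ B)
    (hdiv : ∀ x ∈ Ω, ∑ i, ADR.pderiv i (b i) x = 0)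
    (hμ : 0 < μ) (hq : MemLp q 2 (volume.restrict Ω))
    -- the exact solution, its nodal interpolant, and the finite element solution
    (c cI ch : ADR.Plane → ℝ)
    (hc : ADR.IsWeakSolution Ω D b μ q c)
    (hcI : M.IsNodalInterpolant c cI)
    (hη : M.VanishesOnInterfaces (cI - c))
    (hch : M.IsGalerkinSolution D b μ q ch) :
    (∀ k, M.interpConst D μ k ≤ ENNReal.ofReal (1 / √D₀)) ∧
    ENNReal.ofReal (ADR.energyNorm Ω D b μ (ch - c)) ≤
      ∑ k, M.interpConst D μ k * ENNReal.ofReal (M.diam k) *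
        ADR.normL2 (M.elem k) (ADR.residual D b μ q ch) := by
  obtain ⟨BD, hBD⟩ := hDbdd
  obtain ⟨Bb, hBb⟩ := hbbdd
  have hDm := fun i => ADR.memLp_top_of_contDiffOn hΩ (hD i) (hBD i)
  have hbm := fun i => ADR.memLp_top_of_contDiffOn hΩ (hb i) (hBb i)
  have hDnn : ∀ i, ∀ x ∈ Ω, 0 ≤ D i x := fun i x hx => hD₀.le.trans (hDpos i x hx)
  refine ⟨fun k => ADR.Triangulation.interpConst_le hDm hD₀ hDpos hμ.le k, ?_⟩
  set e := ch - c with he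
  set η := cI - c with hηdef
  have hηe : ch - cI - e = -η := by
    rw [he, hηdef]
    abel
  have hvh : M.MemVh (ch - cI) := hch.1.sub hΩ hcI.2.1
  have heH : ADR.MemH10 Ω e := hch.1.1.sub hΩ hc.1
  have hηH : ADR.MemH10 Ω η := hcI.2.1.1.sub hΩ hc.1
  have hinterp : M.IsNodalInterpolant e (ch - cI) :=
    ⟨hch.1.2.1.sub hcI.1, hvh, fun k j => by simp [he, hcI.2.2 k j]⟩
  have hvanish : M.VanishesOnInterfaces (ch - cI - e) := fun k => by
    have hk := hη k
    -- Membership of `-η` is obtained as that of `(η - η) - η`.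
    have h := ((hk.sub (M.isOpen_elem k) hk).sub (M.isOpen_elem k) hk)
    rwa [sub_self, zero_sub, ← hηe] at h
  set E := ADR.energyNorm Ω D b μ e with hE
  have hEsq : ADR.aForm Ω D b μ e e = E ^ 2 := by
    rw [hE, ADR.energyNorm, Real.sq_sqrt]
    rw [heH.aForm_self hΩ hDm hb hbm hdiv]
    exact setIntegral_nonneg hΩ.measurableSet fun x hx =>
      ADR.energyDensity_nonneg hDnn hμ.le e hx
  -- The constants are applied to `e`, whose interpolation error is `-η`; the local energy norm is
  -- then enlarged to the global one, a common factor of all elements.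
  have hηL2 : ∀ k, ADR.normL2 (M.elem k) η
      ≤ M.interpConst D μ k * (ENNReal.ofReal (M.diam k) * ENNReal.ofReal E) := fun k => by
    have h := ADR.Triangulation.normL2_le_interpConst_mul hDm hD₀ hDpos hμ.le heH hinterp
      hvanish k
    rw [hηe, ADR.normL2, eLpNorm_neg] at h
    refine h.trans ?_
    have hdiam : 0 ≤ M.diam k := Metric.diam_nonneg
    rw [← ENNReal.ofReal_mul hdiam]
    gcongr
    exact heH.localEnergyNorm_le hΩ (M.elem_subset k) hDm hDnn hb hbm hdiv hμ.le
  have hform : IntegrableOn (ADR.formDensity Ω D b μ ch η) Ω :=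
    ADR.integrableOn_formDensity hDm hbm hch.1.1.1 hηH.1
  have hqη : IntegrableOn (fun x => q x * η x) Ω := hq.integrable_fun_mul hηH.1.1
  have hres : IntegrableOn (fun x => ADR.formDensity Ω D b μ ch η x - q x * η x) Ω :=
    hform.sub hqη
  have horth : ADR.aForm Ω D b μ e (ch - cI) = 0 := by
    rw [he, ADR.aForm_sub_left hΩ hDm hbm hch.1.1.1 hc.1.1 hvh.1.1, hch.2 _ hvh,
      hc.2 _ hvh.1, sub_self]
  -- By orthogonality `a(e,e) = a(e,η)`, and `a(c,η) = l(η)` replaces the unknown `c` by the data.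
  have hsplit : ADR.aForm Ω D b μ e e
      = ∑ k, ∫ x in M.elem k, (ADR.formDensity Ω D b μ ch η x - q x * η x) := by
    have h2 : ch - cI = e - η := by
      rw [he, hηdef]
      abel
    have h3 := ADR.aForm_sub_right (μ := μ) hΩ hDm hbm heH.1 heH.1 hηH.1
    rw [← h2, horth] at h3
    have h4 := ADR.aForm_sub_left (μ := μ) hΩ hDm hbm hch.1.1.1 hc.1.1 hηH.1
    rw [← he, hc.2 _ hηH, ADR.aForm_eq_integral hDm hbm hch.1.1.1 hηH.1, ADR.lForm,
      ← integral_sub hform hqη] at h4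
    rw [← M.setIntegral_eq_sum hres, ← h4]
    linarith
  set S := ∑ k, M.interpConst D μ k * ENNReal.ofReal (M.diam k) *
    ADR.normL2 (M.elem k) (ADR.residual D b μ q ch) with hS
  have hmain : ENNReal.ofReal E * ENNReal.ofReal E ≤ S * ENNReal.ofReal E := by
    have hEnn : 0 ≤ E := Real.sqrt_nonneg _
    rw [← ENNReal.ofReal_mul hEnn, ← pow_two, ← hEsq, hsplit]
    refine (ENNReal.ofReal_le_ofReal (le_abs_self _)).trans ?_
    rw [← Real.norm_eq_abs, ofReal_norm]
    refine (enorm_sum_le _ _).trans ?_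
    rw [hS, Finset.sum_mul]
    refine Finset.sum_le_sum fun k _ => ?_
    obtain ⟨A, hA⟩ := hch.1.2.2 k
    refine (ADR.enorm_integral_residual_le (M.isOpen_elem k) (M.elem_subset k)
      (M.volume_elem_ne_top k) hD hDm hbm hq hch.1.1.1 (hA.mono interior_subset) hηH.1
      (hη k)).trans ?_
    refine (mul_le_mul_right (hηL2 k) _).trans_eq ?_
    ring
  -- One factor `E` is cancelled from `E² ≤ S E`; the claim is trivial when `E = 0`.
  by_cases hE0 : ENNReal.ofReal E = 0
  · rw [hE0]
    exact zero_le
  · exact (ENNReal.mul_le_mul_iff_left hE0 ENNReal.ofReal_ne_top).1 hmain
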